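/- Let $I^{\aleph_0}=[0,1]^{\mathbb N}$ be the Hilbert cube with the product topology. An action of a topological group $G$ on $I^{\aleph_0}$ is called continuous if the map $G\times I^{\aleph_0}\to I^{\aleph_0}$, $(g,x)\mapsto g\cdot x$, is (jointly) continuous. A topological group $G$ is called monothetic if it has a subgroup that is both cyclic and dense in $G$, and solenoidal if there is a continuous homomorphism $f:\mathbb R\to G$ whose image is dense in $G$. Then: 1. Every continuous action of the additive topological group $\mathbb R$ on $I^{\aleph_0}$ has a fixed point, that is, there is $x\in I^{\aleph_0}$ with $r\cdot x=x$ for all $r\in\mathbb R$. 2. If $G$ is a monothetic topological group, then every continuous action of $G$ on $I^{\aleph_0}$ has a fixed point. 3. If $G$ is a solenoidal topological group, then every continuous action of $G$ on $I^{\aleph_0}$ has a fixed point. -/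

import Mathlib

/-- The Hilbert cube `I^ℵ₀`, `I = [0, 1]`, with the product topology. -/
abbrev HilbertCube : Type := ℕ → unitInterval

/-- A topological group is monothetic if it has a subgroup that is both cyclic and dense. -/
def IsMonothetic (G : Type*) [Group G] [TopologicalSpace G] : Prop :=
  ∃ H : Subgroup G, IsCyclic H ∧ Dense (H : Set G)

/-- A topological group is solenoidal if there is a continuous homomorphism from the additive group
of the real numbers to it with dense image. -/
def IsSolenoidal (G : Type*) [Group G] [TopologicalSpace G] : Prop :=
  ∃ f : Multiplicative ℝ →* G, Continuous f ∧ DenseRange f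

/-!
Every continuous self-map of the Hilbert cube has a fixed point (`HilbertCube.exists_fixedPoint`),
and this is applied to single elements of the acting group. For a monothetic group, a fixed point of
a generator of the dense cyclic subgroup is fixed by that subgroup, hence by the group, since
stabilizers are closed. For an action of `ℝ`, the fixed points of the maps of time `2⁻ⁿ` form a
decreasing sequence of nonempty compact sets; a common point is fixed by all dyadic times, hence by
`ℝ` (`HilbertCube.exists_fixedPoint_flow`). A solenoidal group is reduced to this case by letting `ℝ`
act through the homomorphism with dense image.

The fixed point property of the Hilbert cube follows by compactness from Brouwer's theorem for the
finite-dimensional faces `[0, 1]ⁿ`, which are retracts of simplices. Brouwer's theorem for the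
simplex (`exists_fixedPoint_stdSimplex`) is deduced from Scarf's lemma (`scarf`), which plays the
role of Sperner's lemma but needs no triangulation: the cells of a triangulation are replaced by the
sets of grid points that are dominant with respect to the rankings by the coordinates, and the parity
argument of Sperner's lemma works for these because the dominant sets are connected by pivots, as in
`exists_pair_dominant_insert_iff`. Dominance forces the points of such a set to be close to each other
(`exists_near_all_colors`).
-/

/-! ### Scarf's lemma on dominant sets -/

section Scarf

variable {I X α : Type*} [LinearOrder α]

/-- A finite set `S` is dominant for a family of rankings `u i : X → α` if no element `y` lies
strictly above the `u i`-minimum of `S` for every index `i`. -/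
def Dominant (u : I → X → α) (S : Finset X) : Prop :=
  ∀ y, ∃ i, ∀ s ∈ S, u i y ≤ u i s

/-- The element `x` is below all of `S` in the ranking `i`, but not the minimum of `insert x S` in
any other ranking. -/
def LowestOnlyIn (u : I → X → α) (S : Finset X) (i : I) (x : X) : Prop :=
  (∀ t ∈ S, u i x < u i t) ∧ ∀ k, k ≠ i → ∃ t ∈ S, u k t < u k x

/-- Every element of `S` is the minimum of `S` in some ranking other than `i`. -/
def CoveredWithout (u : I → X → α) (S : Finset X) (i : I) : Prop :=
  ∀ t ∈ S, ∃ k, k ≠ i ∧ ∀ s ∈ S, u k t ≤ u k s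

variable {u : I → X → α} {S : Finset X}

theorem Dominant.mono {S' : Finset X} (h : Dominant u S) (hS : S' ⊆ S) : Dominant u S' := by
  intro y
  obtain ⟨i, hi⟩ := h y
  exact ⟨i, fun s hs => hi s (hS hs)⟩

variable [DecidableEq X]

/-- In a dominant set with as many elements as there are rankings, mapping an element to a ranking in
which it is the minimum is a bijection; `i` is the ranking assigned to `x`. -/
theorem exists_lowestOnlyIn_of_dominant_insert [Fintype I] [DecidableEq I]
    (hu : ∀ i, Function.Injective (u i)) (hS : S.card + 1 = Fintype.card I)
    {x : X} (hx : x ∉ S) (h : Dominant u (insert x S)) :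
    ∃ i, LowestOnlyIn u S i x ∧ CoveredWithout u S i := by
  obtain ⟨i, hi⟩ := h x
  -- `f t` is a ranking in which `t` is the minimum of `insert x S`.
  choose f hf using h
  have hfi : ∀ t ∈ S, f t ≠ i := by
    rintro t ht rfl
    have h1 := hi t (Finset.mem_insert_of_mem ht)
    have h2 := hf t x (Finset.mem_insert_self _ _)
    exact hx (hu _ (le_antisymm h1 h2) ▸ ht)
  have hinj : Set.InjOn f S := by
    intro s hs t ht hst
    have h1 := hf s t (Finset.mem_insert_of_mem ht)
    have h2 := hf t s (Finset.mem_insert_of_mem hs)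
    rw [hst] at h1
    exact hu _ (le_antisymm h1 h2)
  have himg : S.image f = Finset.univ.erase i := by
    apply Finset.eq_of_subset_of_card_le
    · intro k hk
      obtain ⟨t, ht, rfl⟩ := Finset.mem_image.1 hk
      simp [hfi t ht]
    · rw [Finset.card_image_of_injOn hinj, Finset.card_erase_of_mem (Finset.mem_univ _),
        Finset.card_univ]
      omega
  refine ⟨i, ⟨fun t ht => ?_, fun k hk => ?_⟩, fun t ht => ⟨f t, hfi t ht, fun s hs => ?_⟩⟩
  · refine lt_of_le_of_ne (hi t (Finset.mem_insert_of_mem ht)) fun he => ?_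
    exact hx (hu _ he ▸ ht)
  · have : k ∈ S.image f := by simp [himg, hk]
    obtain ⟨t, ht, rfl⟩ := Finset.mem_image.1 this
    refine ⟨t, ht, lt_of_le_of_ne (hf t x (Finset.mem_insert_self _ _)) fun he => ?_⟩
    exact hx (hu _ he ▸ ht)
  · exact hf t s (Finset.mem_insert_of_mem hs)

theorem LowestOnlyIn.unique (hu : ∀ i, Function.Injective (u i)) {i : I} {x x' : X}
    (hx : LowestOnlyIn u S i x) (hx' : LowestOnlyIn u S i x')
    (h : Dominant u (insert x S)) (h' : Dominant u (insert x' S)) : x = x' := by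
  have key : ∀ {a b : X}, LowestOnlyIn u S i b → Dominant u (insert a S) → u i b ≤ u i a := by
    intro a b hb ha
    obtain ⟨k, hk⟩ := ha b
    by_cases hki : k = i
    · subst hki
      exact hk a (Finset.mem_insert_self _ _)
    · obtain ⟨t, ht, hlt⟩ := hb.2 k hki
      exact absurd (hk t (Finset.mem_insert_of_mem ht)) (not_le.2 hlt)
  exact hu i (le_antisymm (key hx h') (key hx' h))

/-- If some `y` exceeds the minimum of `S` in all rankings but `i`, the one that ranks highest in
`i` extends `S` to a dominant set. -/
theorem exists_dominant_insert [Fintype X] (hu : ∀ i, Function.Injective (u i)) {i : I}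
    (h : Dominant u S)
    (hcov : CoveredWithout u S i) (hne : ∃ y, ∀ k, k ≠ i → ∃ t ∈ S, u k t < u k y) :
    ∃ x, x ∉ S ∧ Dominant u (insert x S) ∧ LowestOnlyIn u S i x := by
  classical
  obtain ⟨y, hy⟩ := hne
  obtain ⟨x, hxM, hmax⟩ := Finset.exists_max_image
    (Finset.univ.filter fun y => ∀ k, k ≠ i → ∃ t ∈ S, u k t < u k y) (u i) ⟨y, by simpa using hy⟩
  have hxM : ∀ k, k ≠ i → ∃ t ∈ S, u k t < u k x := by simpa using hxM
  have hxS : x ∉ S := by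
    intro hx
    obtain ⟨k, hk, hk'⟩ := hcov x hx
    obtain ⟨t, ht, hlt⟩ := hxM k hk
    exact absurd (hk' t ht) (not_le.2 hlt)
  have hlow : ∀ t ∈ S, u i x < u i t := by
    obtain ⟨k, hk⟩ := h x
    by_cases hki : k = i
    · subst hki
      exact fun t ht => lt_of_le_of_ne (hk t ht) fun he => hxS (hu _ he ▸ ht)
    · obtain ⟨t, ht, hlt⟩ := hxM k hki
      exact absurd (hk t ht) (not_le.2 hlt)
  refine ⟨x, hxS, fun y => ?_, hlow, hxM⟩
  by_cases hyM : ∀ k, k ≠ i → ∃ t ∈ S, u k t < u k y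
  · refine ⟨i, fun s hs => ?_⟩
    have hyx : u i y ≤ u i x := hmax y (by simpa using hyM)
    rcases Finset.mem_insert.1 hs with rfl | hs
    · exact hyx
    · exact hyx.trans (hlow s hs).le
  · push Not at hyM
    obtain ⟨k, hk, hk'⟩ := hyM
    refine ⟨k, fun s hs => ?_⟩
    rcases Finset.mem_insert.1 hs with rfl | hs
    · obtain ⟨t, ht, hlt⟩ := hxM k hk
      exact (hk' t ht).trans hlt.le
    · exact hk' s hs

/-- In a dominant set with one element fewer than there are rankings, exactly two rankings share the
minimum element; each of them yields one dominant extension by one element, provided that the set is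
not on the boundary, as expressed by `hext`. -/
theorem exists_pair_dominant_insert_iff [Fintype I] [DecidableEq I] [Fintype X]
    (hu : ∀ i, Function.Injective (u i)) (hS : S.card + 1 = Fintype.card I)
    (h : Dominant u S) (hne : S.Nonempty)
    (hext : ∀ i, ∃ y, ∀ k, k ≠ i → ∃ t ∈ S, u k t < u k y) :
    ∃ x y, x ≠ y ∧ ∀ z, (z ∉ S ∧ Dominant u (insert z S)) ↔ z = x ∨ z = y := by
  -- `m i` is the minimum of `S` in the ranking `i`; by dominance, `m` maps onto `S`.
  choose m hmS hm using fun i => Finset.exists_min_image S (u i) hne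
  have hsurj : ∀ {t i}, (∀ s ∈ S, u i t ≤ u i s) → t ∈ S → m i = t := by
    intro t i ht htS
    exact hu i (le_antisymm (hm i t htS) (ht _ (hmS i)))
  obtain ⟨i, -, j, -, hij, hmij⟩ := Finset.exists_ne_map_eq_of_card_lt_of_maps_to
    (s := Finset.univ) (t := S) (f := m) (by rw [Finset.card_univ]; omega) (fun i _ => hmS i)
  have hcov : ∀ {i j}, i ≠ j → m i = m j → CoveredWithout u S i := by
    intro i j hij hmij t ht
    obtain ⟨k, hk⟩ := h t
    by_cases hki : k = i
    · subst hki
      refine ⟨j, hij.symm, ?_⟩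
      rw [← hsurj hk ht, hmij]
      exact hm j
    · exact ⟨k, hki, hk⟩
  have honly : ∀ k, CoveredWithout u S k → k = i ∨ k = j := by
    intro k hk
    by_contra! hcon
    have hsub : S ⊆ (Finset.univ.erase k).image m := by
      intro t ht
      obtain ⟨l, hl, hl'⟩ := hk t ht
      exact Finset.mem_image.2 ⟨l, by simp [hl], hsurj hl' ht⟩
    have hinj : Set.InjOn m (Finset.univ.erase k : Finset I) := by
      rw [← Finset.card_image_iff]
      refine le_antisymm Finset.card_image_le ?_
      rw [Finset.card_erase_of_mem (Finset.mem_univ _), Finset.card_univ]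
      have := Finset.card_le_card hsub
      omega
    exact hij (hinj (by simp [hcon.1.symm]) (by simp [hcon.2.symm]) hmij)
  have hex : ∀ {i j}, i ≠ j → m i = m j →
      ∃ x, x ∉ S ∧ Dominant u (insert x S) ∧ LowestOnlyIn u S i x := fun {i j} hij hmij =>
    exists_dominant_insert hu h (hcov hij hmij) (hext i)
  obtain ⟨x, hxS, hxd, hxi⟩ := hex hij hmij
  obtain ⟨y, hyS, hyd, hyj⟩ := hex hij.symm hmij.symm
  refine ⟨x, y, ?_, fun z => ⟨?_, ?_⟩⟩
  · rintro rfl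
    obtain ⟨t, ht, hlt⟩ := hyj.2 i hij
    exact lt_asymm hlt (hxi.1 t ht)
  · rintro ⟨hzS, hzd⟩
    obtain ⟨k, hk, hkc⟩ := exists_lowestOnlyIn_of_dominant_insert hu hS hzS hzd
    rcases honly k hkc with rfl | rfl
    · exact Or.inl (hk.unique hu hxi hzd hxd)
    · exact Or.inr (hk.unique hu hyj hzd hyd)
  · rintro (rfl | rfl)
    exacts [⟨hxS, hxd⟩, ⟨hyS, hyd⟩]

/-- The facets of `r` carrying all colours but `i₀` come in pairs, unless `r` carries all colours:
such a facet repeats no colour, so that the missing vertex can be exchanged with the unique vertex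
of the facet that has its colour. -/
theorem exists_pair_of_image_erase {c : X → I} [Fintype I] [DecidableEq I] {i₀ : I} {r : Finset X}
    (hr : r.card = Fintype.card I) (hfull : r.image c ≠ Finset.univ) {x₀ : X} (hx₀ : x₀ ∈ r)
    (h₀ : (r.erase x₀).image c = Finset.univ.erase i₀) :
    ∃ x₁ ∈ r, x₁ ≠ x₀ ∧
      ∀ x ∈ r, (r.erase x).image c = Finset.univ.erase i₀ ↔ x = x₀ ∨ x = x₁ := by
  have hcx₀ : c x₀ ≠ i₀ := by
    intro h
    apply hfull
    rw [← Finset.insert_erase hx₀, Finset.image_insert, h₀, h,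
      Finset.insert_erase (Finset.mem_univ _)]
  have hmem : c x₀ ∈ (r.erase x₀).image c := by simp [h₀, hcx₀]
  obtain ⟨x₁, hx₁, hc⟩ := Finset.mem_image.1 hmem
  have hinj : Set.InjOn c (r.erase x₀ : Finset X) := by
    rw [← Finset.card_image_iff, h₀, Finset.card_erase_of_mem (Finset.mem_univ _),
      Finset.card_erase_of_mem hx₀, Finset.card_univ, hr]
  have hx₁' := Finset.mem_erase.1 hx₁
  refine ⟨x₁, hx₁'.2, hx₁'.1, fun x hx => ⟨fun h => ?_, ?_⟩⟩
  · by_contra! hcon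
    have hxe : x ∈ r.erase x₀ := Finset.mem_erase.2 ⟨hcon.1, hx⟩
    have hcx : c x ∈ (r.erase x).image c := by
      rw [h, ← h₀]
      exact Finset.mem_image_of_mem c hxe
    obtain ⟨z, hz, hzc⟩ := Finset.mem_image.1 hcx
    have hz' := Finset.mem_erase.1 hz
    by_cases hz₀ : z = x₀
    · subst hz₀
      exact hcon.2 (hinj hxe hx₁ (hzc.symm.trans hc.symm))
    · exact hz'.1 (hinj (Finset.mem_erase.2 ⟨hz₀, hz'.2⟩) hxe hzc)
  · rintro (rfl | rfl)
    · exact h₀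
    · rw [← h₀]
      ext k
      simp only [Finset.mem_image, Finset.mem_erase]
      constructor
      · rintro ⟨z, ⟨hz, hzr⟩, rfl⟩
        by_cases hz₀ : z = x₀
        · exact ⟨x, hx₁', by rw [hz₀, hc]⟩
        · exact ⟨z, ⟨hz₀, hzr⟩, rfl⟩
      · rintro ⟨z, ⟨hz, hzr⟩, rfl⟩
        by_cases hz₁ : z = x
        · exact ⟨x₀, ⟨hx₁'.1.symm, hx₀⟩, by rw [hz₁, hc]⟩
        · exact ⟨z, ⟨hz₁, hzr⟩, rfl⟩

/-- The facet formed by all corners `b i` with `i ≠ i₀` has exactly one dominant extension, by the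
element outside the corners that ranks highest in `i₀`. -/
theorem exists_dominant_insert_corners_iff [Fintype I] [DecidableEq I] [Fintype X]
    (hu : ∀ i, Function.Injective (u i)) {b : I → X}
    (hb : ∀ i x, x ≠ b i → u i (b i) < u i x)
    (hb' : ∀ i j, i ≠ j → ∀ x ∉ Set.range b, u i x < u i (b j))
    (hT : ∃ t, t ∉ Set.range b) (i₀ : I) :
    ∃ x, ∀ z, (z ∉ (Finset.univ.erase i₀).image b ∧
      Dominant u (insert z ((Finset.univ.erase i₀).image b))) ↔ z = x := by
  classical
  obtain ⟨t, ht⟩ := hT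
  obtain ⟨x, hx, hmax⟩ := Finset.exists_max_image
    (Finset.univ.filter fun x => x ∉ Set.range b) (u i₀) ⟨t, by simpa using ht⟩
  have hx : x ∉ Set.range b := by simpa using hx
  refine ⟨x, fun z => ⟨?_, ?_⟩⟩
  · rintro ⟨hz, hd⟩
    obtain ⟨i, hi⟩ := hd x
    have hne : ∀ k, b k ∉ insert z ((Finset.univ.erase i₀).image b) ∨ i ≠ k := by
      intro k
      by_contra! hcon
      obtain ⟨h1, rfl⟩ := hcon
      exact absurd (hi _ h1) (not_le.2 (hb i x fun h => hx ⟨i, h.symm⟩))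
    have hii : i = i₀ := by
      by_contra hcon
      rcases hne i with h | h
      · exact h (Finset.mem_insert_of_mem (Finset.mem_image_of_mem _ (by simp [hcon])))
      · exact h rfl
    subst hii
    have hzb : z ∉ Set.range b := by
      rintro ⟨k, rfl⟩
      by_cases hk : k = i
      · subst hk
        rcases hne k with h | h
        · simp at h
        · exact h rfl
      · exact hz (Finset.mem_image_of_mem _ (by simp [hk]))
    exact hu i (le_antisymm (hmax z (by simpa using hzb)) (hi z (Finset.mem_insert_self _ _)))
  · rintro rfl
    refine ⟨fun h => ?_, fun y => ?_⟩
    · obtain ⟨k, -, hk⟩ := Finset.mem_image.1 h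
      exact hx ⟨k, hk⟩
    · by_cases hy : y ∈ Set.range b
      · obtain ⟨k, rfl⟩ := hy
        refine ⟨k, fun s _ => ?_⟩
        by_cases hs : s = b k
        · rw [hs]
        · exact (hb k s hs).le
      · refine ⟨i₀, fun s hs => ?_⟩
        rcases Finset.mem_insert.1 hs with rfl | hs
        · exact hmax y (by simpa using hy)
        · obtain ⟨k, hk, rfl⟩ := Finset.mem_image.1 hs
          exact (hb' i₀ k (Finset.ne_of_mem_erase hk).symm y hy).le

/-- **Scarf's lemma**. Let `b i` be lowest in the ranking `i` and higher than every non-corner in the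
other rankings, and have colour `i`. Then some dominant set carries all colours.

Count pairs `d ⊆ r` of dominant sets, where `r` has as many elements as there are colours and `d` is
a facet carrying all colours except `i₀`. If no `r` carries all colours, each `r` has an even number
of such facets; but each `d` lies in two sets `r`, except for the facet of corners, which lies in
one. -/
theorem scarf [Fintype I] [DecidableEq I] [Nonempty I] [Fintype X]
    (hu : ∀ i, Function.Injective (u i)) {b : I → X}
    (hb : ∀ i x, x ≠ b i → u i (b i) < u i x)
    (hb' : ∀ i j, i ≠ j → ∀ x ∉ Set.range b, u i x < u i (b j))
    (hT : ∃ t, t ∉ Set.range b) {c : X → I} (hc : ∀ i, c (b i) = i) :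
    ∃ r : Finset X, Dominant u r ∧ r.image c = Finset.univ := by
  classical
  by_contra! hcon
  obtain ⟨i₀⟩ := ‹Nonempty I›
  have hbinj : Function.Injective b := fun i j h => by rw [← hc i, h, hc j]
  have hcard : 0 < Fintype.card I := Fintype.card_pos_iff.2 ⟨i₀⟩
  let doors : Finset (Finset X) := Finset.univ.filter fun d =>
    Dominant u d ∧ d.card + 1 = Fintype.card I ∧ d.image c = Finset.univ.erase i₀
  let rooms : Finset (Finset X) := Finset.univ.filter fun r =>
    Dominant u r ∧ r.card = Fintype.card I
  have hcount := Finset.sum_card_bipartiteAbove_eq_sum_card_bipartiteBelow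
    (s := doors) (t := rooms) (fun d r => d ⊆ r)
  have hrooms : Even (∑ r ∈ rooms, (Finset.bipartiteBelow (fun d r => d ⊆ r) doors r).card) := by
    refine Finset.even_sum _ fun r hr => ?_
    obtain ⟨hrd, hrc⟩ : Dominant u r ∧ r.card = Fintype.card I := by simpa [rooms] using hr
    have hiff : ∀ d, d ∈ Finset.bipartiteBelow (fun d r => d ⊆ r) doors r ↔
        ∃ x ∈ r, (r.erase x).image c = Finset.univ.erase i₀ ∧ d = r.erase x := by
      intro d
      simp only [Finset.mem_bipartiteBelow, doors, Finset.mem_filter, Finset.mem_univ, true_and]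
      constructor
      · rintro ⟨⟨-, hdc, hdi⟩, hdr⟩
        obtain ⟨x, hx, rfl⟩ := Finset.exists_eq_insert_iff.2 ⟨hdr, by omega⟩
        exact ⟨x, Finset.mem_insert_self _ _, by rwa [Finset.erase_insert hx],
          by rw [Finset.erase_insert hx]⟩
      · rintro ⟨x, hx, hxi, rfl⟩
        refine ⟨⟨hrd.mono (Finset.erase_subset _ _), ?_, hxi⟩, Finset.erase_subset _ _⟩
        rw [Finset.card_erase_of_mem hx]
        omega
    rcases Finset.eq_empty_or_nonempty (Finset.bipartiteBelow (fun d r => d ⊆ r) doors r) with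
      he | ⟨d, hd⟩
    · simp [he]
    · obtain ⟨x₀, hx₀, h₀, -⟩ := (hiff d).1 hd
      obtain ⟨x₁, hx₁, hne, hall⟩ := exists_pair_of_image_erase hrc (hcon r hrd) hx₀ h₀
      have : Finset.bipartiteBelow (fun d r => d ⊆ r) doors r = {r.erase x₀, r.erase x₁} := by
        ext d
        rw [hiff, Finset.mem_insert, Finset.mem_singleton]
        constructor
        · rintro ⟨x, hx, hxi, rfl⟩
          rcases (hall x hx).1 hxi with rfl | rfl <;> simp
        · rintro (rfl | rfl)
          · exact ⟨x₀, hx₀, h₀, rfl⟩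
          · exact ⟨x₁, hx₁, (hall x₁ hx₁).2 (Or.inr rfl), rfl⟩
      rw [this, Finset.card_pair]
      · exact even_two
      · intro h
        exact hne ((Finset.erase_inj _ hx₀).1 h).symm
  have hiff : ∀ d ∈ doors, ∀ r, r ∈ Finset.bipartiteAbove (fun d r => d ⊆ r) rooms d ↔
      ∃ x, (x ∉ d ∧ Dominant u (insert x d)) ∧ r = insert x d := by
    intro d hd r
    obtain ⟨-, hdc, -⟩ : Dominant u d ∧ d.card + 1 = Fintype.card I ∧
      d.image c = Finset.univ.erase i₀ := by simpa [doors] using hd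
    simp only [Finset.mem_bipartiteAbove, rooms, Finset.mem_filter, Finset.mem_univ, true_and]
    constructor
    · rintro ⟨⟨hrd, hrc⟩, hdr⟩
      obtain ⟨x, hx, rfl⟩ := Finset.exists_eq_insert_iff.2 ⟨hdr, by omega⟩
      exact ⟨x, ⟨hx, hrd⟩, rfl⟩
    · rintro ⟨x, ⟨hx, hrd⟩, rfl⟩
      exact ⟨⟨hrd, by rw [Finset.card_insert_of_notMem hx, hdc]⟩, Finset.subset_insert _ _⟩
  set d₀ : Finset X := (Finset.univ.erase i₀).image b with hd₀
  obtain ⟨x, hx⟩ := exists_dominant_insert_corners_iff hu hb hb' hT i₀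
  have hd₀mem : d₀ ∈ doors := by
    simp only [doors, Finset.mem_filter, Finset.mem_univ, true_and]
    refine ⟨((hx x).2 rfl).2.mono (Finset.subset_insert _ _), ?_, ?_⟩
    · rw [hd₀, Finset.card_image_of_injective _ hbinj,
        Finset.card_erase_of_mem (Finset.mem_univ _), Finset.card_univ]
      omega
    · rw [hd₀, Finset.image_image]
      have : c ∘ b = id := funext hc
      rw [this, Finset.image_id]
  have hone : (Finset.bipartiteAbove (fun d r => d ⊆ r) rooms d₀).card = 1 := by
    rw [Finset.card_eq_one]
    refine ⟨insert x d₀, ?_⟩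
    ext r
    rw [hiff d₀ hd₀mem, Finset.mem_singleton]
    constructor
    · rintro ⟨z, hz, rfl⟩
      rw [(hx z).1 hz]
    · rintro rfl
      exact ⟨x, (hx x).2 rfl, rfl⟩
  have htwo : Even (∑ d ∈ doors.erase d₀,
      (Finset.bipartiteAbove (fun d r => d ⊆ r) rooms d).card) := by
    refine Finset.even_sum _ fun d hd => ?_
    obtain ⟨hdne, hdm⟩ := Finset.mem_erase.1 hd
    obtain ⟨hdd, hdc, hdi⟩ : Dominant u d ∧ d.card + 1 = Fintype.card I ∧
      d.image c = Finset.univ.erase i₀ := by simpa [doors] using hdm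
    obtain ⟨t, htd, htb⟩ : ∃ t ∈ d, t ∉ Set.range b := by
      by_contra! hsub
      apply hdne
      apply Finset.eq_of_subset_of_card_le
      · intro z hz
        obtain ⟨k, rfl⟩ := hsub z hz
        have : c (b k) ∈ d.image c := Finset.mem_image_of_mem c hz
        rw [hdi, hc] at this
        exact Finset.mem_image_of_mem _ this
      · rw [hd₀, Finset.card_image_of_injective _ hbinj,
          Finset.card_erase_of_mem (Finset.mem_univ _), Finset.card_univ]
        omega
    obtain ⟨y, z, hyz, hall⟩ := exists_pair_dominant_insert_iff hu hdc hdd ⟨t, htd⟩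
      fun i => ⟨b i, fun k hk => ⟨t, htd, hb' k i hk t htb⟩⟩
    have : Finset.bipartiteAbove (fun d r => d ⊆ r) rooms d = {insert y d, insert z d} := by
      ext r
      rw [hiff d hdm, Finset.mem_insert, Finset.mem_singleton]
      constructor
      · rintro ⟨x, hx, rfl⟩
        rcases (hall x).1 hx with rfl | rfl <;> simp
      · rintro (rfl | rfl)
        · exact ⟨y, (hall y).2 (Or.inl rfl), rfl⟩
        · exact ⟨z, (hall z).2 (Or.inr rfl), rfl⟩
    rw [this, Finset.card_pair]
    · exact even_two
    · intro h
      exact hyz ((Finset.insert_inj ((hall y).2 (Or.inl rfl)).1).1 h)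
  rw [← Finset.sum_erase_add _ _ hd₀mem, hone] at hcount
  rw [← hcount] at hrooms
  exact (Nat.not_even_iff_odd.2 htwo.add_one) hrooms

end Scarf

/-! ### Brouwer's fixed point theorem for the simplex -/

section Brouwer

variable {I : Type*} [Fintype I]

/-- A Sperner-type lemma without a triangulation: in any colouring of the points of `ℕ^I` with
coordinate sum `N`, there is a point `x` such that each colour `i` is attained near `x`, unless
`x` is close to the face where the coordinate `i` vanishes. -/
theorem exists_near_all_colors [Nonempty I] (N : ℕ) (c : (I → ℕ) → I) :
    ∃ x : I → ℕ, ∑ i, x i = N ∧ ∀ i,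
      (∃ y : I → ℕ, ∑ k, y k = N ∧ c y = i ∧
        ∀ k, x k ≤ y k + Fintype.card I ∧ y k ≤ x k + Fintype.card I) ∨
      x i ≤ Fintype.card I := by
  classical
  let T := {a : I → ℕ // a ∈ Finset.piAntidiag Finset.univ N}
  let : Fintype T := inferInstanceAs (Fintype ↥(Finset.piAntidiag (Finset.univ : Finset I) N))
  have hTmem : ∀ a : I → ℕ, a ∈ Finset.piAntidiag Finset.univ N ↔ ∑ i, a i = N := by
    intro a
    simp [Finset.mem_piAntidiag]
  -- Index the grid by `T` and add one corner for each `i`, lowest in ranking `i` and higher than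
  -- all grid points in the other rankings; ties are broken by an enumeration `e`.
  let v : I → T ⊕ I → ℕ := fun i =>
    Sum.elim (fun a => a.1 i + 1) (fun j => if j = i then 0 else N + 2)
  let e := Fintype.equivFin (T ⊕ I)
  let u : I → T ⊕ I → ℕ ×ₗ Fin (Fintype.card (T ⊕ I)) := fun i x => toLex (v i x, e x)
  have hult : ∀ {i x y}, v i x < v i y → u i x < u i y := fun h =>
    Prod.Lex.toLex_lt_toLex.2 (Or.inl h)
  have hule : ∀ {i x y}, u i x ≤ u i y → v i x ≤ v i y := fun {i x y} h => by
    by_contra! hcon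
    exact absurd h (not_le.2 (hult hcon))
  have hu : ∀ i, Function.Injective (u i) := by
    intro i x y h
    have h2 : (v i x, e x) = (v i y, e y) := toLex.injective h
    exact e.injective (Prod.ext_iff.1 h2).2
  have hbound : ∀ (a : T) i, a.1 i ≤ N := by
    intro a i
    exact (Finset.single_le_sum (f := a.1) (fun _ _ => Nat.zero_le _) (Finset.mem_univ i)).trans
      ((hTmem a.1).1 a.2).le
  obtain ⟨i₁⟩ := ‹Nonempty I›
  have : Nonempty I := ⟨i₁⟩
  obtain ⟨r, hr, himg⟩ := scarf (u := u) hu (b := Sum.inr) (c := Sum.elim (fun a => c a.1) id)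
    (by
      rintro i (a | j) hx
      · exact hult (by simp [v])
      · have : j ≠ i := fun h => hx (by rw [h])
        exact hult (by simp [v, this]))
    (by
      rintro i j hij (a | k) hx
      · have := hbound a i
        exact hult (by simp [v, hij.symm]; omega)
      · exact absurd ⟨k, rfl⟩ hx)
    ⟨Sum.inl ⟨Pi.single i₁ N, (hTmem _).2 (by simp)⟩, by simp⟩ (fun i => rfl)
  have hcolor : ∀ i, ∃ s ∈ r, Sum.elim (fun a : T => c a.1) id s = i := fun i =>
    Finset.mem_image.1 ((Finset.ext_iff.1 himg i).2 (Finset.mem_univ i))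
  have hrne : r.Nonempty := let ⟨s, hs, _⟩ := hcolor i₁; ⟨s, hs⟩
  choose m hmr hm using fun i => Finset.exists_min_image r (v i) hrne
  -- Otherwise a grid point would lie above all the minima, against dominance.
  have hsum : N < ∑ i, v i (m i) := by
    by_contra! hcon
    obtain ⟨i, hi⟩ := hr (Sum.inl ⟨fun i => v i (m i) +
      (Pi.single i₁ (N - ∑ i, v i (m i)) : I → ℕ) i, (hTmem _).2 (by
        rw [Finset.sum_add_distrib]; simp; omega)⟩)
    have := hule (hi _ (hmr i))
    simp only [v, Sum.elim_inl] at this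
    omega
  have hlow : ∀ {y : T}, Sum.inl y ∈ r → ∀ k, v k (m k) ≤ y.1 k + 1 := fun {y} hy k => hm k _ hy
  -- A coordinate far above its minimum would force another one below its minimum.
  have hup : ∀ {y : T}, Sum.inl y ∈ r → ∀ k, y.1 k + 1 ≤ v k (m k) + Fintype.card I := by
    intro y hy k
    have h1 : ∑ i, (y.1 i + 1) = N + Fintype.card I := by
      rw [Finset.sum_add_distrib, (hTmem _).1 y.2]; simp
    have h2 : ∑ i ∈ Finset.univ.erase k, v i (m i) ≤ ∑ i ∈ Finset.univ.erase k, (y.1 i + 1) :=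
      Finset.sum_le_sum fun i _ => hlow hy i
    rw [← Finset.add_sum_erase _ _ (Finset.mem_univ k)] at h1 hsum
    omega
  have hx : ∃ x : T, Sum.inl x ∈ r := by
    by_contra! hcon
    have hzero : ∀ i, v i (m i) = 0 := by
      intro i
      obtain ⟨s, hs, hsi⟩ := hcolor i
      rcases s with a | j
      · exact absurd hs (hcon a)
      · have hji : j = i := hsi
        subst hji
        simpa [v] using hm j _ hs
    simp [hzero] at hsum
  obtain ⟨x, hx⟩ := hx
  refine ⟨x.1, (hTmem _).1 x.2, fun i => ?_⟩
  obtain ⟨s, hs, hsi⟩ := hcolor i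
  rcases s with y | j
  · refine Or.inl ⟨y.1, (hTmem _).1 y.2, hsi, fun k => ?_⟩
    have h1 := hlow hx k
    have h2 := hup hx k
    have h3 := hlow hs k
    have h4 := hup hs k
    omega
  · have hji : j = i := hsi
    subst hji
    have h1 : v j (m j) ≤ 0 := by simpa [v] using hm j _ hs
    have h2 := hup hx j
    exact Or.inr (by omega)

/-- If no coordinate of `F z` falls short of that of `z` by more than a small `ε`, then `z` is almost
fixed, since both have coordinate sum one. Such a `z` is found by colouring each point of a fine grid
with a coordinate that `F` does not decrease there. -/
theorem exists_almost_le_apply [Nonempty I] {F : (I → ℝ) → I → ℝ}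
    (hF : ContinuousOn F (stdSimplex ℝ I)) (hmaps : Set.MapsTo F (stdSimplex ℝ I) (stdSimplex ℝ I))
    {ε : ℝ} (hε : 0 < ε) : ∃ z ∈ stdSimplex ℝ I, ∀ i, z i - ε ≤ F z i := by
  obtain ⟨δ, hδ, hδF⟩ := Metric.uniformContinuousOn_iff.1
    ((isCompact_stdSimplex ℝ I).uniformContinuousOn_of_continuous hF) (ε / 2) (half_pos hε)
  obtain ⟨N, hN⟩ := exists_nat_gt (Fintype.card I / min δ (ε / 2))
  have hmin : 0 < min δ (ε / 2) := lt_min hδ (half_pos hε)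
  have hN0 : (0 : ℝ) < N := lt_of_le_of_lt (by positivity) hN
  have hNc : (Fintype.card I : ℝ) / N < min δ (ε / 2) := by
    rw [div_lt_iff₀ hmin] at hN
    rw [div_lt_iff₀ hN0]
    linarith
  let q : (I → ℕ) → I → ℝ := fun a i => a i / N
  have hq : ∀ a : I → ℕ, ∑ i, a i = N → q a ∈ stdSimplex ℝ I := by
    intro a ha
    refine ⟨fun i => by positivity, ?_⟩
    have h : (∑ i, (a i : ℝ)) = N := by exact_mod_cast ha
    simp only [q]
    rw [← Finset.sum_div, h, div_self hN0.ne']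
  -- Both points of the simplex have coordinate sum one, so some coordinate does not decrease.
  have hcol : ∀ a : I → ℕ, ∃ i, ∑ i, a i = N → q a i ≤ F (q a) i := by
    intro a
    by_contra! hcon
    obtain ⟨i₁⟩ := ‹Nonempty I›
    have ha := (hcon i₁).1
    have hlt : ∑ i, F (q a) i < ∑ i, q a i :=
      Finset.sum_lt_sum_of_nonempty ⟨i₁, Finset.mem_univ _⟩ fun i _ => (hcon i).2
    rw [(hmaps (hq a ha)).2, (hq a ha).2] at hlt
    exact lt_irrefl _ hlt
  choose c hc using hcol
  obtain ⟨x, hx, hxc⟩ := exists_near_all_colors N c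
  refine ⟨q x, hq x hx, fun i => ?_⟩
  rcases hxc i with ⟨y, hy, rfl, hxy⟩ | hi
  · have hdist : ∀ k, dist (q x k) (q y k) ≤ Fintype.card I / N := by
      intro k
      have h1 : (x k : ℝ) ≤ y k + Fintype.card I := by exact_mod_cast (hxy k).1
      have h2 : (y k : ℝ) ≤ x k + Fintype.card I := by exact_mod_cast (hxy k).2
      rw [Real.dist_eq, ← sub_div, abs_div, abs_of_pos hN0]
      gcongr
      rw [abs_le]
      constructor <;> linarith
    have hxy' : dist (q x) (q y) ≤ Fintype.card I / N := (dist_pi_le_iff (by positivity)).2 hdist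
    have h1 := hδF _ (hq x hx) _ (hq y hy) (hxy'.trans_lt (hNc.trans_le (min_le_left _ _)))
    have h2 := (dist_le_pi_dist (F (q x)) (F (q y)) (c y)).trans_lt h1
    have h3 := (hdist (c y)).trans_lt (hNc.trans_le (min_le_right _ _))
    have h4 := hc y hy
    rw [Real.dist_eq, abs_lt] at h2 h3
    linarith
  · have h1 : q x i ≤ Fintype.card I / N := by
      simp only [q]
      gcongr
    have h2 := hNc.trans_le (min_le_right _ _)
    have h3 := (hmaps (hq x hx)).1 i
    linarith

/-- **Brouwer's fixed point theorem** for the standard simplex. -/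
theorem exists_fixedPoint_stdSimplex [Nonempty I] {F : (I → ℝ) → I → ℝ}
    (hF : ContinuousOn F (stdSimplex ℝ I))
    (hmaps : Set.MapsTo F (stdSimplex ℝ I) (stdSimplex ℝ I)) :
    ∃ z ∈ stdSimplex ℝ I, F z = z := by
  -- The total decrease of the coordinates attains its minimum, which is zero.
  let g : (I → ℝ) → ℝ := fun z => ∑ i, max (z i - F z i) 0
  have hg : ContinuousOn g (stdSimplex ℝ I) := by
    refine continuousOn_finsetSum _ fun i _ => ContinuousOn.sup ?_ continuousOn_const
    exact (continuous_apply i).continuousOn.sub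
      ((continuous_apply i).comp_continuousOn hF)
  obtain ⟨w, hw, -⟩ := exists_almost_le_apply hF hmaps one_pos
  obtain ⟨z, hz, hmin⟩ := (isCompact_stdSimplex ℝ I).exists_isMinOn ⟨w, hw⟩ hg
  have hgz : g z ≤ 0 := by
    refine le_of_forall_pos_le_add fun ε hε => ?_
    have hcard : (0 : ℝ) < Fintype.card I := by exact_mod_cast Fintype.card_pos
    obtain ⟨y, hy, hyi⟩ := exists_almost_le_apply hF hmaps (div_pos hε hcard)
    calc g z ≤ g y := hmin hy
      _ ≤ ∑ _i : I, ε / Fintype.card I := Finset.sum_le_sum fun i _ =>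
          max_le (by linarith [hyi i]) (by positivity)
      _ = 0 + ε := by simp; field_simp
  have hle : ∀ i, z i ≤ F z i := by
    intro i
    have h1 : max (z i - F z i) 0 ≤ g z :=
      Finset.single_le_sum (f := fun i => max (z i - F z i) 0) (fun _ _ => le_max_right _ _)
        (Finset.mem_univ i)
    linarith [le_max_left (z i - F z i) 0]
  refine ⟨z, hz, funext fun i => ?_⟩
  have hsum : ∑ i, z i = ∑ i, F z i := by rw [hz.2, (hmaps hz).2]
  exact ((Finset.sum_eq_sum_iff_of_le fun i _ => hle i).1 hsum i (Finset.mem_univ i)).symm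

end Brouwer

/-! ### The fixed point property of the Hilbert cube -/

section FixedPoint

/-- Brouwer's theorem on the face `[0, 1]ⁿ`: `f` has a point that is fixed up to the coordinates
from `n` on. -/
theorem exists_forall_lt_apply_eq {f : HilbertCube → HilbertCube} (hf : Continuous f) (n : ℕ) :
    ∃ x, ∀ k < n, f x k = x k := by
  -- `retr` maps the simplex onto the face `[0, 1]ⁿ` of the cube and is a left inverse of the
  -- embedding `x ↦ (1 - ∑ xₖ / n, x₀ / n, …, xₙ₋₁ / n)` of that face.
  let retr : (Option (Fin n) → ℝ) → HilbertCube := fun y k =>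
    if h : k < n then Set.projIcc 0 1 zero_le_one (n * y (some ⟨k, h⟩)) else 0
  have hretr : Continuous retr := by
    refine continuous_pi fun k => ?_
    by_cases h : k < n
    · simp only [retr, h, dite_true]
      exact continuous_projIcc.comp (continuous_const.mul (continuous_apply _))
    · simp only [retr, h, dite_false]
      exact continuous_const
  let F : (Option (Fin n) → ℝ) → Option (Fin n) → ℝ := fun y o =>
    o.elim (1 - ∑ k : Fin n, (f (retr y) k : ℝ) / n) fun k => (f (retr y) k : ℝ) / n
  have hcoord : ∀ k : ℕ, Continuous fun y => (f (retr y) k : ℝ) / n := fun k =>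
    (continuous_subtype_val.comp ((continuous_apply k).comp (hf.comp hretr))).div_const _
  have hF : Continuous F := by
    refine continuous_pi fun o => ?_
    cases o with
    | none => exact continuous_const.sub (continuous_finsetSum _ fun k _ => hcoord k)
    | some k => exact hcoord k
  have hmaps : Set.MapsTo F (stdSimplex ℝ (Option (Fin n))) (stdSimplex ℝ (Option (Fin n))) := by
    intro y _
    refine ⟨fun o => ?_, ?_⟩
    · cases o with
      | none =>
        have : ∑ k : Fin n, (f (retr y) k : ℝ) / n ≤ ∑ _k : Fin n, (1 : ℝ) / n :=
          Finset.sum_le_sum fun k _ => by gcongr; exact (f (retr y) k).2.2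
        have h1 : ∑ _k : Fin n, (1 : ℝ) / n ≤ 1 := by
          simpa [div_eq_mul_inv] using div_self_le_one (n : ℝ)
        simp only [F, Option.elim_none]
        linarith
      | some k => exact div_nonneg (f (retr y) k).2.1 (Nat.cast_nonneg _)
    · simp [F, Fintype.sum_option]
  obtain ⟨y, -, hy⟩ := exists_fixedPoint_stdSimplex hF.continuousOn hmaps
  refine ⟨retr y, fun k hk => ?_⟩
  have hn : (n : ℝ) ≠ 0 := by
    have : n ≠ 0 := by omega
    exact_mod_cast this
  have hyk : (f (retr y) k : ℝ) / n = y (some ⟨k, hk⟩) := congrFun hy (some ⟨k, hk⟩)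
  have hyk' : (n : ℝ) * y (some ⟨k, hk⟩) = f (retr y) k := by
    rw [← hyk]
    field_simp
  have : retr y k = Set.projIcc 0 1 zero_le_one (f (retr y) k : ℝ) := by
    rw [← hyk']
    simp [retr, hk]
  rw [this, Set.projIcc_val]

/-- The **Hilbert cube has the fixed point property**: the points fixed in the first `n` coordinates
form a decreasing sequence of nonempty compact sets. -/
theorem HilbertCube.exists_fixedPoint {f : HilbertCube → HilbertCube} (hf : Continuous f) :
    ∃ x, f x = x := by
  have hclosed : ∀ n : ℕ, IsClosed {x | ∀ k < n, f x k = x k} := by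
    intro n
    simp only [Set.ofPred_forall]
    exact isClosed_iInter fun k => isClosed_iInter fun _ =>
      isClosed_eq ((continuous_apply k).comp hf) (continuous_apply k)
  obtain ⟨x, hx⟩ := IsCompact.nonempty_iInter_of_sequence_nonempty_isCompact_isClosed
    (fun n : ℕ => {x | ∀ k < n, f x k = x k}) (fun n x hx k hk => hx k (hk.trans n.lt_succ_self))
    (exists_forall_lt_apply_eq hf) (hclosed 0).isCompact hclosed
  exact ⟨x, funext fun k => Set.mem_iInter.1 hx (k + 1) k k.lt_succ_self⟩

/-! ### Fixed points of actions -/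

/-- The fixed points of the time `2⁻ⁿ` maps form a decreasing sequence of nonempty compact sets,
and a point fixed by all of them is fixed by the dense set of dyadic times. -/
theorem HilbertCube.exists_fixedPoint_flow {φ : ℝ → HilbertCube → HilbertCube}
    (hφ : Continuous fun p : ℝ × HilbertCube => φ p.1 p.2) (h0 : ∀ x, φ 0 x = x)
    (hadd : ∀ r s x, φ (r + s) x = φ r (φ s x)) : ∃ x, ∀ r, φ r x = x := by
  have hspace : ∀ r, Continuous (φ r) := fun r =>
    hφ.comp (continuous_const.prodMk continuous_id)
  have hclosed : ∀ n : ℕ, IsClosed {x | φ ((1 / 2) ^ n) x = x} := fun n =>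
    isClosed_eq (hspace _) continuous_id
  obtain ⟨x, hx⟩ := IsCompact.nonempty_iInter_of_sequence_nonempty_isCompact_isClosed
    (fun n : ℕ => {x | φ ((1 / 2) ^ n) x = x})
    (fun n x hx => by
      have hx : φ ((1 / 2) ^ (n + 1)) x = x := hx
      have hhalf : ((1 / 2) ^ n : ℝ) = (1 / 2) ^ (n + 1) + (1 / 2) ^ (n + 1) := by ring
      change φ ((1 / 2) ^ n) x = x
      rw [hhalf, hadd, hx, hx])
    (fun n => HilbertCube.exists_fixedPoint (hspace _)) (hclosed 0).isCompact hclosed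
  have hx : ∀ n : ℕ, φ ((1 / 2) ^ n) x = x := fun n => Set.mem_iInter.1 hx n
  let A : AddSubgroup ℝ :=
    { carrier := {r | φ r x = x}
      zero_mem' := h0 x
      add_mem' := fun {r s} hr hs => by
        change φ (r + s) x = x
        rw [hadd, show φ s x = x from hs, show φ r x = x from hr]
      neg_mem' := fun {r} hr => by
        change φ (-r) x = x
        conv_lhs => rw [← show φ r x = x from hr]
        rw [← hadd, neg_add_cancel, h0] }
  have hA : Dense (A : Set ℝ) := A.dense_of_not_isolated_zero fun ε hε => by
    obtain ⟨n, hn⟩ := exists_pow_lt_of_lt_one hε (by norm_num : (1 / 2 : ℝ) < 1)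
    exact ⟨(1 / 2) ^ n, hx n, by positivity, hn⟩
  have hAc : IsClosed (A : Set ℝ) :=
    isClosed_eq (hφ.comp (continuous_id.prodMk continuous_const)) continuous_const
  refine ⟨x, fun r => ?_⟩
  have : r ∈ (A : Set ℝ) := by
    rw [← hAc.closure_eq, hA.closure_eq]
    trivial
  exact this

theorem smul_eq_of_dense {G X : Type*} [Group G] [TopologicalSpace G] [TopologicalSpace X]
    [T2Space X] [MulAction G X] [ContinuousSMul G X] {s : Set G} (hs : Dense s) {x : X}
    (hx : ∀ g ∈ s, g • x = x) (g : G) : g • x = x :=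
  congrFun (Continuous.ext_on (f := fun g : G => g • x) (g := fun _ => x) hs
    (continuous_id.smul continuous_const) continuous_const hx) g

end FixedPoint

theorem mainTheorem11 :
    (∀ [AddAction ℝ HilbertCube] [ContinuousVAdd ℝ HilbertCube],
      ∃ x : HilbertCube, ∀ r : ℝ, r +ᵥ x = x) ∧
    (∀ (G : Type*) [Group G] [TopologicalSpace G] [IsTopologicalGroup G],
      IsMonothetic G →
      ∀ [MulAction G HilbertCube] [ContinuousSMul G HilbertCube],
        ∃ x : HilbertCube, ∀ g : G, g • x = x) ∧
    (∀ (G : Type*) [Group G] [TopologicalSpace G] [IsTopologicalGroup G],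
      IsSolenoidal G →
      ∀ [MulAction G HilbertCube] [ContinuousSMul G HilbertCube],
        ∃ x : HilbertCube, ∀ g : G, g • x = x) := by
  refine ⟨?_, ?_, ?_⟩
  · intro _ _
    exact HilbertCube.exists_fixedPoint_flow (φ := fun r x => r +ᵥ x) continuous_vadd
      (fun x => zero_vadd ℝ x) (fun r s x => add_vadd r s x)
  · intro G _ _ _ hG _ _
    obtain ⟨H, hH, hdense⟩ := hG
    obtain ⟨a, ha⟩ := hH.exists_zpow_surjective
    obtain ⟨x, hx⟩ := HilbertCube.exists_fixedPoint (continuous_const_smul (a : G))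
    refine ⟨x, smul_eq_of_dense hdense fun g hg => ?_⟩
    obtain ⟨n, hn⟩ := ha ⟨g, hg⟩
    have hg' : g = (a : G) ^ n := (congrArg Subtype.val hn).symm
    rw [hg']
    exact zpow_mem (show (a : G) ∈ MulAction.stabilizer G x from hx) n
  · intro G _ _ _ hG _ _
    obtain ⟨f, hf, hdense⟩ := hG
    obtain ⟨x, hx⟩ := HilbertCube.exists_fixedPoint_flow
      (φ := fun r x => f (Multiplicative.ofAdd r) • x)
      ((hf.comp (continuous_ofAdd.comp continuous_fst)).smul continuous_snd)
      (fun x => by simp) (fun r s x => by simp [mul_smul])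
    refine ⟨x, smul_eq_of_dense hdense ?_⟩
    rintro _ ⟨r, rfl⟩
    exact hx r.toAdd
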